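/- **Setting.** Let $n\ge 1$ and consider the system $x(t+1)=Ax(t)+Bu(t)+w(t)$, $y(t)=Cx(t)+v(t)$, $t\ge 0$, with $x(t)\in\mathbb R^n$, $u(t)\in\mathbb R^m$, $y(t)\in\mathbb R^l$, where $w(t)\sim\mathcal N(0,W)$ and $v(t)\sim\mathcal N(0,V)$ are independent at all times, $W\succeq 0$, $V\succ 0$, the pairs $(A,B)$ and $(A,W^{1/2})$ are controllable, and $(A,C)$ is observable. Let $Q\succeq 0$, $R\succ0$ be the weight matrices of the target LQG task, with $(A,Q^{1/2})$ observable. Let $L_{\mathrm f}$ be the steady-state Kalman gain, $K_{\mathrm{LQR}}$ the LQR gain for the target weights (both given by the positive semidefinite solutions of the corresponding algebraic Riccati equations), and let $$\hat x(t+1)=E\hat x(t)+Fu(t)+Gy(t+1),\qquad u(t)=K_{\mathrm{LQR}}\hat x(t),$$ with $E=(I-L_{\mathrm f}C)A$, $F=(I-L_{\mathrm f}C)B$, $G=L_{\mathrm f}$, be the LQG compensator. Assume that $(E,L_{\mathrm f})$ is controllable and that $(E,K_{\mathrm{LQR},i})$ is observable for every row $K_{\mathrm{LQR},i}$ of $K_{\mathrm{LQR}}$.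 The pair $(x(0),\hat x(0))$ may be random; $(x(0),\hat x(0),v(0))$ is independent of $(w(s))_{s\ge 0}$ and $(v(s))_{s\ge 1}$. Let $a=(a_0,\dots,a_{n-1})$ be the negatives of the coefficients of the characteristic polynomial of $E$, so that $E^n=\sum_{i=0}^{n-1} a_iE^i$, and define $$L_{\mathrm{est}}=\begin{bmatrix}F_u-(a\otimes I_n)\tilde M_u & F_y-(a\otimes I_n)\tilde M_y\\ a\otimes I_m&0\end{bmatrix},$$ where $F_u=[E^{n-1}F\ \cdots\ F]$, $F_y=[E^{n-1}G\ \cdots\ G]$, and $\tilde M_u$, $\tilde M_y$ are the $n\times n$ block matrices with $(i,j)$ block $E^{i-j-1}F$, respectively $E^{i-j-1}G$, for $i>j$, and $0$ otherwise. Put $K_{\mathrm{target}}=[K_{\mathrm{LQR}}\ \ I_m]$. For a closed-loop (expert) trajectory $(u,y)$ and a starting time $t\ge0$ put $$U_n(s)=\begin{bmatrix}u(s)\\ \vdots\\ u(s+n-1)\end{bmatrix},\quad Y_n(s+1)=\begin{bmatrix}y(s+1)\\ \vdots\\ y(s+n)\end{bmatrix},\quad H_{n,c}=\begin{bmatrix}U_n(t)&\cdots&U_n(t+c-1)\\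 Y_n(t+1)&\cdots&Y_n(t+c)\end{bmatrix},$$ and $\bar U_c=[u(t+n)\ \cdots\ u(t+n+c-1)]$. Both are formed from the data $u,y$ on the times $t,\dots,t+\bar T$ when $c=\bar T-n+1$. **Theorem** (length of expert trajectory to learn the target LQG controller). 1. $L_{\mathrm{est}}$ has full row rank $n+m$. 2. Suppose $n+m\le n(l+1)$ and fix $t\ge0$. Almost surely, if the expert trajectory satisfies the persistency-of-excitation condition $\operatorname{Ker}(L_{\mathrm{est}})\cap\operatorname{Im}(H_{n,n+m})=\{0\}$, then the target controller is determined by $L_{\mathrm{est}}$ and one expert trajectory of any length $\bar T\ge 2n+m-1$: * the square matrix $L_{\mathrm{est}}H_{n,n+m}$ is invertible and $K_{\mathrm{target}}=\bar U_{n+m}\,(L_{\mathrm{est}}H_{n,n+m})^{-1}$; * $K_{\mathrm{LQG}}=K_{\mathrm{target}}L_{\mathrm{est}}$ is a static LQG gain, that is, $u(s+n)=K_{\mathrm{LQG}}\begin{bmatrix}U_n(s)\\Y_n(s+1)\end{bmatrix}$ for all $s\ge 0$ along every trajectory of the compensator; * for every $\bar T\ge 2n+m-1$, with $c=\bar T-n+1$,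 and for every matrix $\hat L_{\mathrm{est}}$ with $L_{\mathrm{est}}=P\hat L_{\mathrm{est}}$, $P$ invertible, the equation $\bar U_c=\hat K\hat L_{\mathrm{est}}H_{n,c}$ has exactly one solution $\hat K$, namely $\hat K=K_{\mathrm{target}}P$ (so that $\hat K\hat L_{\mathrm{est}}=K_{\mathrm{target}}L_{\mathrm{est}}$). -/

import Mathlib

open Matrix MeasureTheory ProbabilityTheory
open scoped MatrixOrder

noncomputable section

namespace LQG

/-- The controllability matrix `[B  AB  ⋯  A^(n-1) B]` of the pair `(A, B)`. -/
def controllabilityMatrix {n p : ℕ} (A : Matrix (Fin n) (Fin n) ℝ)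
    (B : Matrix (Fin n) (Fin p) ℝ) : Matrix (Fin n) (Fin n × Fin p) ℝ :=
  Matrix.of fun i q => (A ^ (q.1 : ℕ) * B) i q.2

/-- The pair `(A, B)` is controllable. -/
def IsControllable {n p : ℕ} (A : Matrix (Fin n) (Fin n) ℝ)
    (B : Matrix (Fin n) (Fin p) ℝ) : Prop :=
  (controllabilityMatrix A B).rank = n

/-- The observability matrix `[C; CA; ⋯; C A^(n-1)]` of the pair `(A, C)`. -/
def observabilityMatrix {n p : ℕ} (A : Matrix (Fin n) (Fin n) ℝ)
    (C : Matrix (Fin p) (Fin n) ℝ) : Matrix (Fin n × Fin p) (Fin n) ℝ :=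
  Matrix.of fun q j => (C * A ^ (q.1 : ℕ)) q.2 j

/-- The pair `(A, C)` is observable. -/
def IsObservable {n p : ℕ} (A : Matrix (Fin n) (Fin n) ℝ)
    (C : Matrix (Fin p) (Fin n) ℝ) : Prop :=
  (observabilityMatrix A C).rank = n

/-- The `i`-th row of `K`, as a matrix with one row. -/
def rowMatrix {m n : ℕ} (K : Matrix (Fin m) (Fin n) ℝ) (i : Fin m) :
    Matrix (Fin 1) (Fin n) ℝ :=
  K.submatrix (fun _ => i) id

/-- `K` is the LQR gain (of the optimal law `u = K x`) of the system `(A, B)` with weights `Q`,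
`R`: it is built from the positive semidefinite solution of the discrete-time algebraic Riccati
equation, which is unique when `(A, B)` is controllable and `(A, Q^(1/2))` is observable. -/
def IsLQRGain {n m : ℕ} (A : Matrix (Fin n) (Fin n) ℝ) (B : Matrix (Fin n) (Fin m) ℝ)
    (Q : Matrix (Fin n) (Fin n) ℝ) (R : Matrix (Fin m) (Fin m) ℝ)
    (K : Matrix (Fin m) (Fin n) ℝ) : Prop :=
  ∃ P : Matrix (Fin n) (Fin n) ℝ, P.PosSemidef ∧
    P = Aᵀ * P * A - Aᵀ * P * B * (R + Bᵀ * P * B)⁻¹ * (Bᵀ * P * A) + Q ∧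
    K = -((R + Bᵀ * P * B)⁻¹ * (Bᵀ * P * A))

/-- `L` is the (steady-state, filtering form) Kalman gain of the system `(A, C)` with process
noise covariance `W` and measurement noise covariance `V`: it is built from the positive
semidefinite solution of the filtering algebraic Riccati equation, which is unique when `(A, C)`
is observable and `(A, W^(1/2))` is controllable. -/
def IsKalmanGain {n l : ℕ} (A : Matrix (Fin n) (Fin n) ℝ) (C : Matrix (Fin l) (Fin n) ℝ)
    (W : Matrix (Fin n) (Fin n) ℝ) (V : Matrix (Fin l) (Fin l) ℝ)
    (L : Matrix (Fin n) (Fin l) ℝ) : Prop :=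
  ∃ S : Matrix (Fin n) (Fin n) ℝ, S.PosSemidef ∧
    S = A * S * Aᵀ - A * S * Cᵀ * (C * S * Cᵀ + V)⁻¹ * (C * S * Aᵀ) + W ∧
    L = S * Cᵀ * (C * S * Cᵀ + V)⁻¹

/-- The compensator matrix `E = (I - L C) A`. -/
def compE {n l : ℕ} (A : Matrix (Fin n) (Fin n) ℝ) (C : Matrix (Fin l) (Fin n) ℝ)
    (L : Matrix (Fin n) (Fin l) ℝ) : Matrix (Fin n) (Fin n) ℝ :=
  (1 - L * C) * A

/-- The compensator matrix `F = (I - L C) B`. -/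
def compF {n m l : ℕ} (B : Matrix (Fin n) (Fin m) ℝ) (C : Matrix (Fin l) (Fin n) ℝ)
    (L : Matrix (Fin n) (Fin l) ℝ) : Matrix (Fin n) (Fin m) ℝ :=
  (1 - L * C) * B

/-- The sequences `xh`, `u`, `y` obey the dynamic compensator
`xh(t+1) = E xh(t) + F u(t) + G y(t+1)`, `u(t) = H xh(t)`. -/
structure IsCompensatorTrajectory {n m l : ℕ} (E : Matrix (Fin n) (Fin n) ℝ)
    (F : Matrix (Fin n) (Fin m) ℝ) (G : Matrix (Fin n) (Fin l) ℝ)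
    (H : Matrix (Fin m) (Fin n) ℝ)
    (xh : ℕ → Fin n → ℝ) (u : ℕ → Fin m → ℝ) (y : ℕ → Fin l → ℝ) : Prop where
  estimate : ∀ t, xh (t + 1) = E *ᵥ xh t + F *ᵥ u t + G *ᵥ y (t + 1)
  input : ∀ t, u t = H *ᵥ xh t

/-- The sequences `x`, `u`, `y` obey the system
`x(t+1) = A x(t) + B u(t) + w(t)`, `y(t) = C x(t) + v(t)` with noise sequences `w`, `v`. -/
structure IsSystemTrajectory {n m l : ℕ} (A : Matrix (Fin n) (Fin n) ℝ)
    (B : Matrix (Fin n) (Fin m) ℝ) (C : Matrix (Fin l) (Fin n) ℝ)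
    (w : ℕ → Fin n → ℝ) (v : ℕ → Fin l → ℝ)
    (x : ℕ → Fin n → ℝ) (u : ℕ → Fin m → ℝ) (y : ℕ → Fin l → ℝ) : Prop where
  state : ∀ t, x (t + 1) = A *ᵥ x t + B *ᵥ u t + w t
  output : ∀ t, y t = C *ᵥ x t + v t

/-- The noise model: `w(t) ~ N(0, W)` and `v(t) ~ N(0, V)` are independent at all times, and
independent of the initial state `x0`.  The initial estimate `xh0` is allowed to depend on the
measurement at time `0`, that is on `v(0)`. -/
structure IsNoise {n l : ℕ} {Ω : Type*} [MeasurableSpace Ω] (μ : Measure Ω)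
    (W : Matrix (Fin n) (Fin n) ℝ) (V : Matrix (Fin l) (Fin l) ℝ)
    (x0 xh0 : Ω → Fin n → ℝ) (w : ℕ → Ω → Fin n → ℝ) (v : ℕ → Ω → Fin l → ℝ) : Prop where
  measurable_x0 : Measurable x0
  measurable_xh0 : Measurable xh0
  measurable_w : ∀ t, Measurable (w t)
  measurable_v : ∀ t, Measurable (v t)
  law_w : ∀ t, μ.map (fun ω => WithLp.toLp 2 (w t ω)) = multivariateGaussian 0 W
  law_v : ∀ t, μ.map (fun ω => WithLp.toLp 2 (v t ω)) = multivariateGaussian 0 V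
  indep_w : iIndepFun w μ
  indep_v : iIndepFun v μ
  indep_w_v : IndepFun (fun ω t => w t ω) (fun ω t => v t ω) μ
  indep_initial : IndepFun (fun ω => (x0 ω, xh0 ω, v 0 ω))
    (fun ω => (fun t => w t ω, fun t => v (t + 1) ω)) μ

/-- The stacked vector `[U_r(t); Y_r(t+1)]` with `U_r(t) = [u(t); ⋯; u(t+r-1)]` and
`Y_r(t+1) = [y(t+1); ⋯; y(t+r)]`. -/
def window {m l : ℕ} (r : ℕ) (u : ℕ → Fin m → ℝ) (y : ℕ → Fin l → ℝ) (t : ℕ) :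
    (Fin r × Fin m) ⊕ (Fin r × Fin l) → ℝ :=
  Sum.elim (fun p => u (t + p.1) p.2) (fun p => y (t + 1 + p.1) p.2)

/-- The data matrix `H_{r,c}`, with columns `[U_r(t+j); Y_r(t+1+j)]`, `j = 0, …, c-1`. -/
def dataMatrix {m l : ℕ} (r c : ℕ) (u : ℕ → Fin m → ℝ) (y : ℕ → Fin l → ℝ) (t : ℕ) :
    Matrix ((Fin r × Fin m) ⊕ (Fin r × Fin l)) (Fin c) ℝ :=
  Matrix.of fun i j => window r u y (t + j) i

/-- The input matrix `Ū_c = [u(t+r)  ⋯  u(t+r+c-1)]`. -/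
def inputMatrix {m : ℕ} (r c : ℕ) (u : ℕ → Fin m → ℝ) (t : ℕ) : Matrix (Fin m) (Fin c) ℝ :=
  Matrix.of fun i j => u (t + r + j) i

/-- The vector `a = (a_0, …, a_{n-1})` of the negatives of the coefficients of the characteristic
polynomial of `E`. -/
def recurrence {n : ℕ} (E : Matrix (Fin n) (Fin n) ℝ) : Fin n → ℝ :=
  fun i => -E.charpoly.coeff i

/-- `E ^ n = a_0 I + a_1 E + ⋯ + a_{n-1} E ^ (n-1)`. -/
theorem pow_eq_recurrence {n : ℕ} (E : Matrix (Fin n) (Fin n) ℝ) :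
    E ^ n = ∑ i : Fin n, recurrence E i • E ^ (i : ℕ) := by
  have h := Matrix.aeval_self_charpoly E
  have hd : E.charpoly.natDegree = n := by simp [Matrix.charpoly_natDegree_eq_dim]
  have hc : E.charpoly.coeff n = 1 := by
    have := (Matrix.charpoly_monic E).coeff_natDegree
    rwa [hd] at this
  rw [Polynomial.aeval_eq_sum_range, hd, Finset.sum_range_succ, hc, one_smul,
    ← Fin.sum_univ_eq_sum_range (fun i => E.charpoly.coeff i • E ^ i)] at h
  simp only [recurrence, neg_smul, Finset.sum_neg_distrib]
  exact eq_neg_of_add_eq_zero_right h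

/-- The Kronecker product `a ⊗ I_k` of the row vector `a` with the identity matrix. -/
def rowKronecker {n : ℕ} (a : Fin n → ℝ) (k : ℕ) : Matrix (Fin k) (Fin n × Fin k) ℝ :=
  Matrix.of fun i q => a q.1 * (1 : Matrix (Fin k) (Fin k) ℝ) i q.2

/-- The matrix `[E^(n-1) D  ⋯  E D  D]`: it is `F_u` for `D = F` and `F_y` for `D = G`. -/
def powerRow {n p : ℕ} (E : Matrix (Fin n) (Fin n) ℝ) (D : Matrix (Fin n) (Fin p) ℝ) :
    Matrix (Fin n) (Fin n × Fin p) ℝ :=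
  Matrix.of fun i q => (E ^ (n - 1 - (q.1 : ℕ)) * D) i q.2

/-- The strictly lower block triangular Toeplitz matrix with blocks `E^(i-j-1) D` for `j < i`:
it is `M̃_u` for `D = F` and `M̃_y` for `D = G`. -/
def powerToeplitz {n p : ℕ} (E : Matrix (Fin n) (Fin n) ℝ) (D : Matrix (Fin n) (Fin p) ℝ) :
    Matrix (Fin n × Fin n) (Fin n × Fin p) ℝ :=
  Matrix.of fun r q =>
    if q.1 < r.1 then (E ^ ((r.1 : ℕ) - (q.1 : ℕ) - 1) * D) r.2 q.2 else 0

/-- The estimation matrix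
`L_est = [F_u - (a ⊗ I_n) M̃_u, F_y - (a ⊗ I_n) M̃_y; a ⊗ I_m, 0]`, with `n + m` rows. -/
def estimationMatrix {n m l : ℕ} (E : Matrix (Fin n) (Fin n) ℝ)
    (F : Matrix (Fin n) (Fin m) ℝ) (G : Matrix (Fin n) (Fin l) ℝ) :
    Matrix (Fin (n + m)) ((Fin n × Fin m) ⊕ (Fin n × Fin l)) ℝ :=
  Matrix.reindex finSumFinEquiv (Equiv.refl _)
    (Matrix.fromBlocks
      (powerRow E F - rowKronecker (recurrence E) n * powerToeplitz E F)
      (powerRow E G - rowKronecker (recurrence E) n * powerToeplitz E G)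
      (rowKronecker (recurrence E) m) 0)

/-- The control matrix `[K  I_m]`, with `n + m` columns, where `K` is the LQR gain. -/
def controlMatrix {n m : ℕ} (K : Matrix (Fin m) (Fin n) ℝ) : Matrix (Fin m) (Fin (n + m)) ℝ :=
  Matrix.reindex (Equiv.refl _) finSumFinEquiv (Matrix.fromCols K 1)

/-- `K` is a static form of the compensator: `u(t+n) = K [U_n(t); Y_n(t+1)]` for all times along
all trajectories of the compensator with state matrices of size `n`. -/
def IsStaticGain {n m l : ℕ} (E : Matrix (Fin n) (Fin n) ℝ)
    (F : Matrix (Fin n) (Fin m) ℝ) (G : Matrix (Fin n) (Fin l) ℝ)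
    (H : Matrix (Fin m) (Fin n) ℝ)
    (K : Matrix (Fin m) ((Fin n × Fin m) ⊕ (Fin n × Fin l)) ℝ) : Prop :=
  ∀ (xh : ℕ → Fin n → ℝ) (u : ℕ → Fin m → ℝ) (y : ℕ → Fin l → ℝ),
    IsCompensatorTrajectory E F G H xh u y → ∀ t, u (t + n) = K *ᵥ window n u y t

/-- Persistency of excitation: `Ker(L) ∩ Im(H) = {0}`. -/
def IsPersistentlyExciting {α β γ : Type*} [Fintype β] [Fintype γ]
    (L : Matrix α β ℝ) (H : Matrix β γ ℝ) : Prop :=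
  LinearMap.ker L.mulVecLin ⊓ LinearMap.range H.mulVecLin = ⊥

end LQG

end

open Matrix MeasureTheory ProbabilityTheory
open scoped MatrixOrder

noncomputable section

namespace LQG

/-! Everything rests on one identity along compensator trajectories: `Lest` sends a window to the
residual `xh(t+n) - ∑ a_i xh(t+i)` stacked over `∑ a_i u(t+i)`, the free responses `E^i xh(t)`
cancelling by Cayley–Hamilton. Since `u = K xh`, applying `[K I]` returns `u(t+n)`; this is both the
static gain and the data equation.

Full row rank: the triangular shape of the output block and controllability of `(E, Lf)` kill the
first part of a left null vector. The second part dies because `a_0 ≠ 0`, that is, because `E` is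
invertible, which follows from the Riccati forms of the two gains.

Invertibility of `Lest * H`: by excitation, `Lest H c = 0` forces `H c = 0`. The corresponding
combination of shifted trajectories then has zero window, hence zero estimate by observability. So
it suffices that the stacked states `ζ(s) = (xh(s), y(s+1), …, y(s+n))`, `s = t, …, t+n+m-1`, be
independent. Otherwise some `ζ(t+k)` lies in the span `S` of its predecessors. Its newest output
carries nondegenerate Gaussian noise independent of them, so almost surely `S` contains every
direction of that output (`ae_lastOutput_mem_span`). Then `S` is shift-invariant and equals `X ×
ℝ^(nl)`, with all estimates in `X` (`exists_span_eq_prod`). With `d = dim X`, `d + nl ≤ k < n + m ≤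
n(l+1)` gives `d < n`. But excitation bounds the rank of the stacked states by that of vectors in `X
× X`, so `d + nl ≤ 2d` and `nl ≤ d < n`, impossible for `l ≥ 1`. -/

/-! ### Rank conditions as kernel conditions. -/

theorem IsObservable.eq_zero {n p : ℕ} {A : Matrix (Fin n) (Fin n) ℝ}
    {C : Matrix (Fin p) (Fin n) ℝ} (h : IsObservable A C) {z : Fin n → ℝ}
    (hz : ∀ k < n, C *ᵥ (A ^ k *ᵥ z) = 0) : z = 0 := by
  have hker : Module.finrank ℝ (LinearMap.ker (observabilityMatrix A C).mulVecLin) = 0 := by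
    have h1 := (observabilityMatrix A C).mulVecLin.finrank_range_add_finrank_ker
    have h2 : (observabilityMatrix A C).rank = n := h
    rw [Matrix.rank] at h2
    simp only [Module.finrank_fin_fun] at h1
    omega
  have hb := Submodule.finrank_eq_zero.mp hker
  refine LinearMap.ker_eq_bot'.mp hb z ?_
  ext q
  have := congrFun (hz q.1 q.1.2) q.2
  rw [Matrix.mulVec_mulVec] at this
  exact this

theorem IsControllable.eq_zero {n p : ℕ} {A : Matrix (Fin n) (Fin n) ℝ}
    {B : Matrix (Fin n) (Fin p) ℝ} (h : IsControllable A B) {z : Fin n → ℝ}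
    (hz : ∀ k < n, z ᵥ* (A ^ k * B) = 0) : z = 0 := by
  have hT : (controllabilityMatrix A B)ᵀ.rank = n := by rw [Matrix.rank_transpose]; exact h
  have hker : Module.finrank ℝ
      (LinearMap.ker (controllabilityMatrix A B)ᵀ.mulVecLin) = 0 := by
    have h1 := (controllabilityMatrix A B)ᵀ.mulVecLin.finrank_range_add_finrank_ker
    rw [Matrix.rank] at hT
    simp only [Module.finrank_fin_fun] at h1
    omega
  have hb := Submodule.finrank_eq_zero.mp hker
  refine LinearMap.ker_eq_bot'.mp hb z ?_
  ext q
  have := congrFun (hz q.1 q.1.2) q.2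
  rw [Matrix.mulVecLin_apply, Matrix.mulVec_transpose]
  exact this

theorem IsControllable.pos_of_pos {n p : ℕ} {A : Matrix (Fin n) (Fin n) ℝ}
    {B : Matrix (Fin n) (Fin p) ℝ} (h : IsControllable A B) (hn : 0 < n) : 0 < p := by
  rcases Nat.eq_zero_or_pos p with rfl | hp
  · have h1 : (fun _ => 1 : Fin n → ℝ) = 0 := h.eq_zero fun k _ => Subsingleton.elim _ _
    simpa using congrFun h1 ⟨0, hn⟩
  · exact hp

theorem IsObservable.pos_of_pos {n p : ℕ} {A : Matrix (Fin n) (Fin n) ℝ}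
    {C : Matrix (Fin p) (Fin n) ℝ} (h : IsObservable A C) (hn : 0 < n) : 0 < p := by
  rcases Nat.eq_zero_or_pos p with rfl | hp
  · have h1 : (fun _ => 1 : Fin n → ℝ) = 0 := h.eq_zero fun k _ => Subsingleton.elim _ _
    simpa using congrFun h1 ⟨0, hn⟩
  · exact hp

/-! ### Invertibility of the compensator matrix `E`. -/

/-- With `M = C S Cᵀ + V` and `e = M⁻¹ C g`, the equation `g = L C g` reads `g = S Cᵀ e`. Hence `M e
= C g = C S Cᵀ e`, so `V e = 0`, and `V ≻ 0` gives `e = 0`. -/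
theorem IsKalmanGain.eq_zero_of_mulVec_eq_zero {n l : ℕ} {A : Matrix (Fin n) (Fin n) ℝ}
    {C : Matrix (Fin l) (Fin n) ℝ} {W : Matrix (Fin n) (Fin n) ℝ} {V : Matrix (Fin l) (Fin l) ℝ}
    {L : Matrix (Fin n) (Fin l) ℝ} (hV : V.PosDef) (hL : IsKalmanGain A C W V L)
    {g : Fin n → ℝ} (hg : (1 - L * C) *ᵥ g = 0) : g = 0 := by
  obtain ⟨S, hS, -, hL⟩ := hL
  have hM : (C * S * Cᵀ + V).PosDef := by
    refine Matrix.PosDef.posSemidef_add ?_ hV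
    simpa using hS.mul_mul_conjTranspose_same C
  set M := C * S * Cᵀ + V with hMdef
  have hMu : IsUnit M.det := (Matrix.isUnit_iff_isUnit_det M).mp hM.isUnit
  set e := M⁻¹ *ᵥ (C *ᵥ g) with he
  have h1 : g = (S * Cᵀ) *ᵥ e := by
    rw [Matrix.sub_mulVec, Matrix.one_mulVec, sub_eq_zero] at hg
    rw [he, Matrix.mulVec_mulVec, ← hL, Matrix.mulVec_mulVec]
    exact hg
  have h2 : M *ᵥ e = C *ᵥ g := by
    rw [he, Matrix.mulVec_mulVec, Matrix.mul_nonsing_inv _ hMu, Matrix.one_mulVec]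
  have h3 : V *ᵥ e = 0 := by
    have h4 : C *ᵥ g = (C * S * Cᵀ) *ᵥ e := by
      conv_lhs => rw [h1]
      rw [Matrix.mulVec_mulVec, Matrix.mul_assoc]
    rw [hMdef, Matrix.add_mulVec, ← h4] at h2
    simpa using h2
  have h5 : e = 0 := by
    have hVu : IsUnit V := hV.isUnit
    exact (Matrix.mulVec_injective_iff_isUnit.mpr hVu) (by rw [h3, Matrix.mulVec_zero])
  rw [h1, h5, Matrix.mulVec_zero]

/-- An observable compensator built from the Kalman and LQR gains has an invertible state
matrix. -/
theorem det_compE_ne_zero {n m l : ℕ} {A : Matrix (Fin n) (Fin n) ℝ}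
    {B : Matrix (Fin n) (Fin m) ℝ}
    {C : Matrix (Fin l) (Fin n) ℝ} {W : Matrix (Fin n) (Fin n) ℝ} {V : Matrix (Fin l) (Fin l) ℝ}
    {Q : Matrix (Fin n) (Fin n) ℝ} {R : Matrix (Fin m) (Fin m) ℝ}
    {K : Matrix (Fin m) (Fin n) ℝ} {L : Matrix (Fin n) (Fin l) ℝ}
    (hV : V.PosDef) (hK : IsLQRGain A B Q R K) (hL : IsKalmanGain A C W V L)
    (i : Fin m) (hobs : IsObservable (compE A C L) (rowMatrix K i)) :
    (compE A C L).det ≠ 0 := by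
  intro hdet
  obtain ⟨z, hz0, hz⟩ := Matrix.exists_mulVec_eq_zero_iff.mpr hdet
  have hA : A *ᵥ z = 0 := by
    refine hL.eq_zero_of_mulVec_eq_zero hV ?_
    rw [Matrix.mulVec_mulVec]
    exact hz
  -- The LQR gain has `A` as its rightmost factor, so it vanishes on the kernel of `A`; together
  -- with `E z = 0` this makes `z` unobservable.
  have hKz : K *ᵥ z = 0 := by
    obtain ⟨P, -, -, hK⟩ := hK
    rw [hK, Matrix.neg_mulVec, ← Matrix.mulVec_mulVec, ← Matrix.mulVec_mulVec, hA]
    simp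
  refine hz0 (hobs.eq_zero fun k _ => ?_)
  rcases k with _ | k
  · ext j
    rw [pow_zero, Matrix.one_mulVec]
    exact congrFun hKz i
  · rw [pow_succ, ← Matrix.mulVec_mulVec, hz, Matrix.mulVec_zero, Matrix.mulVec_zero]

theorem recurrence_zero_ne_zero {n : ℕ} (hn : 0 < n) {E : Matrix (Fin n) (Fin n) ℝ}
    (hE : E.det ≠ 0) : recurrence E ⟨0, hn⟩ ≠ 0 := by
  intro h
  apply hE
  rw [Matrix.det_eq_sign_charpoly_coeff]
  have : E.charpoly.coeff 0 = 0 := by simpa [recurrence] using h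
  rw [this, mul_zero]

/-! ### Full row rank of the estimation matrix. -/

theorem rowKronecker_mul_apply {n k : ℕ} {β : Type*} (a : Fin n → ℝ)
    (M : Matrix (Fin n × Fin k) β ℝ) (r : Fin k) (q : β) :
    (rowKronecker a k * M) r q = ∑ i, a i * M (i, r) q := by
  rw [Matrix.mul_apply, Fintype.sum_prod_type]
  refine Finset.sum_congr rfl fun i _ => ?_
  simp [rowKronecker, Matrix.one_apply]

theorem rowKronecker_mulVec {n k : ℕ} (a : Fin n → ℝ) (v : Fin n × Fin k → ℝ) (r : Fin k) :
    (rowKronecker a k *ᵥ v) r = ∑ i, a i * v (i, r) := by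
  rw [Matrix.mulVec, dotProduct, Fintype.sum_prod_type]
  refine Finset.sum_congr rfl fun i _ => ?_
  simp [rowKronecker, Matrix.one_apply]

/-- Column block `n-1-k` equals `E^k G` minus a combination of lower powers `E^j G`, `j < k`. The
system is thus triangular, and `z E^k G = 0` follows by strong induction for any `a`. -/
theorem eq_zero_of_vecMul_powerRow_sub {n p : ℕ} {E : Matrix (Fin n) (Fin n) ℝ}
    {G : Matrix (Fin n) (Fin p) ℝ} (h : IsControllable E G) (a : Fin n → ℝ) {z : Fin n → ℝ}
    (hz : z ᵥ* (powerRow E G - rowKronecker a n * powerToeplitz E G) = 0) : z = 0 := by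
  refine h.eq_zero fun k hk => ?_
  induction k using Nat.strong_induction_on with
  | _ k ih =>
    ext c
    have hj := congrFun hz (⟨n - 1 - k, by omega⟩, c)
    rw [Matrix.vecMul_sub] at hj
    have h1 : (z ᵥ* powerRow E G) (⟨n - 1 - k, by omega⟩, c) = (z ᵥ* (E ^ k * G)) c := by
      have : n - 1 - (n - 1 - k) = k := by omega
      simp [Matrix.vecMul, dotProduct, powerRow, this]
    have h2 : (z ᵥ* (rowKronecker a n * powerToeplitz E G)) (⟨n - 1 - k, by omega⟩, c) = 0 := by
      simp only [Matrix.vecMul, dotProduct, rowKronecker_mul_apply, Finset.mul_sum]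
      rw [Finset.sum_comm]
      refine Finset.sum_eq_zero fun i _ => ?_
      by_cases hi : n - 1 - k < (i : ℕ)
      · have h3 := congrFun (ih ((i : ℕ) - (n - 1 - k) - 1) (by omega) (by omega)) c
        simp only [Matrix.vecMul, dotProduct, Pi.zero_apply] at h3
        have : ∀ r, z r * (a i * powerToeplitz E G (i, r) (⟨n - 1 - k, by omega⟩, c)) =
            a i * (z r * (E ^ ((i : ℕ) - (n - 1 - k) - 1) * G) r c) := by
          intro r
          simp only [powerToeplitz, Matrix.of_apply, Fin.lt_def, if_pos hi]
          ring
        simp only [this]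
        rw [← Finset.mul_sum, h3, mul_zero]
      · have : ∀ r, powerToeplitz E G (i, r) (⟨n - 1 - k, by omega⟩, c) = 0 := fun r => if_neg hi
        simp [this]
    rw [Pi.sub_apply, h1, h2, sub_zero] at hj
    exact hj

/-- The estimation matrix has full row rank. -/
theorem rank_estimationMatrix {n m l : ℕ} (hn : 0 < n) {E : Matrix (Fin n) (Fin n) ℝ}
    (F : Matrix (Fin n) (Fin m) ℝ) {G : Matrix (Fin n) (Fin l) ℝ}
    (hE : E.det ≠ 0) (hctr : IsControllable E G) :
    (estimationMatrix E F G).rank = n + m := by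
  have hli : LinearIndependent ℝ (estimationMatrix E F G).row := by
    rw [← Matrix.vecMul_injective_iff, ← Matrix.coe_vecMulLinear, ← LinearMap.ker_eq_bot,
      LinearMap.ker_eq_bot']
    intro z hz
    obtain ⟨z, rfl⟩ : ∃ z' : Fin n ⊕ Fin m → ℝ, z = z' ∘ finSumFinEquiv.symm :=
      ⟨z ∘ finSumFinEquiv, by ext; simp⟩
    rw [Matrix.vecMulLinear_apply, estimationMatrix, Matrix.reindex_apply] at hz
    have hz' : z ᵥ* Matrix.fromBlocks
      (powerRow E F - rowKronecker (recurrence E) n * powerToeplitz E F)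
      (powerRow E G - rowKronecker (recurrence E) n * powerToeplitz E G)
      (rowKronecker (recurrence E) m) 0 = 0 := by
      rw [Matrix.submatrix_vecMul_equiv] at hz
      simpa [Function.comp_assoc] using hz
    rw [Matrix.vecMul_fromBlocks] at hz'
    have h1 : z ∘ Sum.inl = 0 := by
      refine eq_zero_of_vecMul_powerRow_sub hctr (recurrence E) ?_
      ext q
      simpa using congrFun hz' (Sum.inr q)
    have h2 : z ∘ Sum.inr = 0 := by
      ext j
      -- Only the block `a_0 I` of the last rows is needed, and `a_0 ≠ 0`.
      have := congrFun hz' (Sum.inl (⟨0, hn⟩, j))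
      rw [h1] at this
      simp only [Matrix.zero_vecMul, zero_add, Sum.elim_inl, Matrix.vecMul, dotProduct,
        rowKronecker, Matrix.of_apply, Pi.zero_apply, Matrix.one_apply] at this
      simpa [recurrence_zero_ne_zero hn hE] using this
    ext q
    obtain ⟨q, rfl⟩ := finSumFinEquiv.surjective q
    rcases q with q | q
    · simpa using congrFun h1 q
    · simpa using congrFun h2 q
  rw [hli.rank_matrix, Fintype.card_fin]

/-! ### Algebra of compensator trajectories. -/

section Trajectory

variable {n m l : ℕ} {E : Matrix (Fin n) (Fin n) ℝ} {F : Matrix (Fin n) (Fin m) ℝ}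
  {G : Matrix (Fin n) (Fin l) ℝ} {K : Matrix (Fin m) (Fin n) ℝ}
  {xh : ℕ → Fin n → ℝ} {u : ℕ → Fin m → ℝ} {y : ℕ → Fin l → ℝ}

theorem IsCompensatorTrajectory.estimate_add (h : IsCompensatorTrajectory E F G K xh u y)
    (t k : ℕ) : xh (t + k) = E ^ k *ᵥ xh t +
      ∑ j ∈ Finset.range k,
        ((E ^ (k - 1 - j) * F) *ᵥ u (t + j) + (E ^ (k - 1 - j) * G) *ᵥ y (t + 1 + j)) := by
  induction k with
  | zero => simp
  | succ k ih =>
    rw [← add_assoc, h.estimate, ih, Finset.sum_range_succ, Matrix.mulVec_add,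
      Matrix.mulVec_sum, Matrix.mulVec_mulVec, ← pow_succ', show t + k + 1 = t + 1 + k by ring]
    have : ∀ j ∈ Finset.range k, E *ᵥ ((E ^ (k - 1 - j) * F) *ᵥ u (t + j) +
        (E ^ (k - 1 - j) * G) *ᵥ y (t + 1 + j)) =
        (E ^ (k + 1 - 1 - j) * F) *ᵥ u (t + j) + (E ^ (k + 1 - 1 - j) * G) *ᵥ y (t + 1 + j) := by
      intro j hj
      have hj := Finset.mem_range.mp hj
      rw [Matrix.mulVec_add, Matrix.mulVec_mulVec, Matrix.mulVec_mulVec, ← Matrix.mul_assoc,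
        ← Matrix.mul_assoc, ← pow_succ', show k - 1 - j + 1 = k + 1 - 1 - j by omega]
    rw [Finset.sum_congr rfl this]
    simp [add_assoc]

theorem powerRow_mulVec {p : ℕ} (D : Matrix (Fin n) (Fin p) ℝ) (v : ℕ → Fin p → ℝ) :
    (powerRow E D *ᵥ fun q => v q.1 q.2) =
      ∑ j ∈ Finset.range n, (E ^ (n - 1 - j) * D) *ᵥ v j := by
  ext r
  rw [Matrix.mulVec, dotProduct, Fintype.sum_prod_type, Finset.sum_apply,
    ← Fin.sum_univ_eq_sum_range (fun j => ((E ^ (n - 1 - j) * D) *ᵥ v j) r)]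
  rfl

theorem powerToeplitz_mulVec {p : ℕ} (D : Matrix (Fin n) (Fin p) ℝ) (v : ℕ → Fin p → ℝ)
    (i r : Fin n) :
    (powerToeplitz E D *ᵥ fun q => v q.1 q.2) (i, r) =
      (∑ j ∈ Finset.range i, (E ^ ((i : ℕ) - 1 - j) * D) *ᵥ v j) r := by
  rw [Matrix.mulVec, dotProduct, Fintype.sum_prod_type, Finset.sum_apply]
  have h1 : ∀ j : Fin n, ∑ q : Fin p, powerToeplitz E D (i, r) (j, q) * v j q =
      (fun j : ℕ => if j < (i : ℕ) then ((E ^ ((i : ℕ) - 1 - j) * D) *ᵥ v j) r else 0) j := by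
    intro j
    by_cases hj : (j : ℕ) < i
    · simp only [powerToeplitz, Matrix.of_apply, Fin.lt_def, if_pos hj,
        show (i : ℕ) - j - 1 = i - 1 - j by omega]
      rfl
    · have : ∀ q, powerToeplitz E D (i, r) (j, q) = 0 := fun q => if_neg hj
      simp [this, hj]
  rw [Finset.sum_congr rfl fun j _ => h1 j, Fin.sum_univ_eq_sum_range
    (fun j : ℕ => if j < (i : ℕ) then ((E ^ ((i : ℕ) - 1 - j) * D) *ᵥ v j) r else 0) n,
    ← Finset.sum_filter]
  congr 1
  ext j
  simp only [Finset.mem_filter, Finset.mem_range]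
  omega

/-- The estimation matrix maps a window of a compensator trajectory to the residuals of the
recurrence of the state and of the input. -/
theorem IsCompensatorTrajectory.estimationMatrix_mulVec
    (h : IsCompensatorTrajectory E F G K xh u y) (t : ℕ) :
    estimationMatrix E F G *ᵥ window n u y t =
      Sum.elim (xh (t + n) - ∑ i : Fin n, recurrence E i • xh (t + i))
        (∑ i : Fin n, recurrence E i • u (t + i)) ∘ finSumFinEquiv.symm := by
  have hu : powerRow E F *ᵥ (fun p : Fin n × Fin m => u (t + p.1) p.2) = _ :=
    powerRow_mulVec F fun j => u (t + j)
  have hy : powerRow E G *ᵥ (fun p : Fin n × Fin l => y (t + 1 + p.1) p.2) = _ :=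
    powerRow_mulVec G fun j => y (t + 1 + j)
  have hTu : ∀ i r, (powerToeplitz E F *ᵥ fun p => u (t + p.1) p.2) (i, r) = _ :=
    powerToeplitz_mulVec F fun j => u (t + j)
  have hTy : ∀ i r, (powerToeplitz E G *ᵥ fun p => y (t + 1 + p.1) p.2) (i, r) = _ :=
    powerToeplitz_mulVec G fun j => y (t + 1 + j)
  have hrow : ∀ r : Fin n, ((powerRow E F - rowKronecker (recurrence E) n * powerToeplitz E F) *ᵥ
      (fun p : Fin n × Fin m => u (t + p.1) p.2) +
      (powerRow E G - rowKronecker (recurrence E) n * powerToeplitz E G) *ᵥ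
      (fun p : Fin n × Fin l => y (t + 1 + p.1) p.2)) r =
      (xh (t + n) - ∑ i : Fin n, recurrence E i • xh (t + i)) r := by
    intro r
    -- Block row `i` of the Toeplitz matrices gives the forced response after `i` steps.
    have hx : ∀ i : Fin n, (powerToeplitz E F *ᵥ fun p => u (t + p.1) p.2) (i, r) +
        (powerToeplitz E G *ᵥ fun p => y (t + 1 + p.1) p.2) (i, r) =
        xh (t + i) r - (E ^ (i : ℕ) *ᵥ xh t) r := by
      intro i
      rw [hTu, hTy, h.estimate_add t i, Finset.sum_add_distrib]
      simp only [Pi.add_apply]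
      ring
    have hn := h.estimate_add t n
    rw [Matrix.sub_mulVec, Matrix.sub_mulVec, ← Matrix.mulVec_mulVec, ← Matrix.mulVec_mulVec]
    simp only [Pi.add_apply, Pi.sub_apply, rowKronecker_mulVec]
    -- Cayley–Hamilton turns the weighted free responses into `E^n xh(t)`, which is the free part of
    -- `xh(t+n)`.
    have hsum : ∑ i, recurrence E i * (powerToeplitz E F *ᵥ fun p => u (t + p.1) p.2) (i, r) +
        ∑ i, recurrence E i * (powerToeplitz E G *ᵥ fun p => y (t + 1 + p.1) p.2) (i, r) =
        (∑ i : Fin n, recurrence E i • xh (t + i)) r - (E ^ n *ᵥ xh t) r := by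
      rw [← Finset.sum_add_distrib]
      simp only [← mul_add, hx]
      rw [pow_eq_recurrence E, Matrix.sum_mulVec]
      simp [mul_sub, Finset.sum_apply, Matrix.smul_mulVec]
    rw [hn, Finset.sum_add_distrib, hu, hy]
    simp only [Pi.add_apply]
    linarith
  ext q
  obtain ⟨q, rfl⟩ := finSumFinEquiv.surjective q
  rw [estimationMatrix, Matrix.reindex_apply]
  have : (Matrix.submatrix (Matrix.fromBlocks
      (powerRow E F - rowKronecker (recurrence E) n * powerToeplitz E F)
      (powerRow E G - rowKronecker (recurrence E) n * powerToeplitz E G)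
      (rowKronecker (recurrence E) m) 0) finSumFinEquiv.symm (Equiv.refl _).symm *ᵥ
        window n u y t) (finSumFinEquiv q) = (Matrix.fromBlocks
      (powerRow E F - rowKronecker (recurrence E) n * powerToeplitz E F)
      (powerRow E G - rowKronecker (recurrence E) n * powerToeplitz E G)
      (rowKronecker (recurrence E) m) 0 *ᵥ window n u y t) q := by
    simp [Matrix.mulVec, dotProduct]
  rw [this, window, Matrix.fromBlocks_mulVec]
  rcases q with r | r
  · simpa using hrow r
  · simp [rowKronecker_mulVec]

/-- `K` times the state residual is `u(t+n) - ∑ a_i u(t+i)`, and the second block of the estimate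
adds the sum back. -/
theorem IsCompensatorTrajectory.controlMatrix_mulVec
    (h : IsCompensatorTrajectory E F G K xh u y) (t : ℕ) :
    controlMatrix K *ᵥ (estimationMatrix E F G *ᵥ window n u y t) = u (t + n) := by
  rw [h.estimationMatrix_mulVec]
  have : ∀ v : Fin n ⊕ Fin m → ℝ, controlMatrix K *ᵥ (v ∘ finSumFinEquiv.symm) =
      K *ᵥ (v ∘ Sum.inl) + v ∘ Sum.inr := by
    intro v
    rw [controlMatrix, Matrix.reindex_apply, Matrix.submatrix_mulVec_equiv]
    ext i
    simp [Matrix.fromCols_mulVec, Function.comp_assoc]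
  rw [this, h.input (t + n)]
  simp only [Sum.elim_comp_inl, Sum.elim_comp_inr, Matrix.mulVec_sub, Matrix.mulVec_sum,
    Matrix.mulVec_smul, h.input, sub_add_cancel]

theorem isStaticGain_controlMatrix_mul_estimationMatrix (E : Matrix (Fin n) (Fin n) ℝ)
    (F : Matrix (Fin n) (Fin m) ℝ) (G : Matrix (Fin n) (Fin l) ℝ) (K : Matrix (Fin m) (Fin n) ℝ) :
    IsStaticGain E F G K (controlMatrix K * estimationMatrix E F G) := by
  intro xh u y h t
  rw [← Matrix.mulVec_mulVec, h.controlMatrix_mulVec]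

theorem IsCompensatorTrajectory.inputMatrix_eq (h : IsCompensatorTrajectory E F G K xh u y)
    (t c : ℕ) : inputMatrix n c u t =
      controlMatrix K * (estimationMatrix E F G * dataMatrix n c u y t) := by
  ext i j
  have := congrFun (h.controlMatrix_mulVec (t + j)) i
  rw [Matrix.mulVec_mulVec] at this
  rw [← Matrix.mul_assoc, inputMatrix, Matrix.of_apply, show t + n + j = t + j + n by ring, ← this]
  rfl

/-- Linear combinations of shifts of a compensator trajectory are compensator trajectories. -/
theorem IsCompensatorTrajectory.sum_smul_shift (h : IsCompensatorTrajectory E F G K xh u y)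
    {N : ℕ} (c : Fin N → ℝ) : IsCompensatorTrajectory E F G K
      (fun t => ∑ j, c j • xh (t + j)) (fun t => ∑ j, c j • u (t + j))
      (fun t => ∑ j, c j • y (t + j)) where
  estimate t := by
    simp only [Matrix.mulVec_sum, Matrix.mulVec_smul, ← Finset.sum_add_distrib, ← smul_add]
    refine Finset.sum_congr rfl fun j _ => ?_
    rw [show t + 1 + (j : ℕ) = t + j + 1 by ring, h.estimate]
  input t := by
    simp only [Matrix.mulVec_sum, Matrix.mulVec_smul, h.input]

/-- Lets an element of the image of the data matrix be treated as the window of a single compensator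
trajectory, via `sum_smul_shift`. -/
theorem dataMatrix_mulVec (u : ℕ → Fin m → ℝ) (y : ℕ → Fin l → ℝ) (r N t : ℕ)
    (c : Fin N → ℝ) : dataMatrix r N u y t *ᵥ c =
      window r (fun t => ∑ j, c j • u (t + j)) (fun t => ∑ j, c j • y (t + j)) t := by
  ext q
  rcases q with q | q
  · simp only [Matrix.mulVec, dotProduct, dataMatrix, Matrix.of_apply, window, Sum.elim_inl,
      Finset.sum_apply, Pi.smul_apply, smul_eq_mul]
    exact Finset.sum_congr rfl fun j _ => by
      rw [mul_comm, show t + (j : ℕ) + q.1 = t + q.1 + j by ring]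
  · simp only [Matrix.mulVec, dotProduct, dataMatrix, Matrix.of_apply, window, Sum.elim_inr,
      Finset.sum_apply, Pi.smul_apply, smul_eq_mul]
    exact Finset.sum_congr rfl fun j _ => by
      rw [mul_comm, show t + (j : ℕ) + 1 + q.1 = t + 1 + q.1 + j by ring]

/-- If the window of a compensator trajectory vanishes, then so does the state. -/
theorem IsCompensatorTrajectory.estimate_eq_zero (h : IsCompensatorTrajectory E F G K xh u y)
    (i : Fin m) (hobs : IsObservable E (rowMatrix K i)) {t : ℕ} (hw : window n u y t = 0) :
    xh t = 0 := by
  have hu : ∀ k < n, u (t + k) = 0 := fun k hk => by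
    ext r; exact congrFun hw (Sum.inl (⟨k, hk⟩, r))
  have hy : ∀ k < n, y (t + 1 + k) = 0 := fun k hk => by
    ext r; exact congrFun hw (Sum.inr (⟨k, hk⟩, r))
  refine hobs.eq_zero fun k hk => ?_
  have hx : xh (t + k) = E ^ k *ᵥ xh t := by
    rw [h.estimate_add t k, Finset.sum_eq_zero, add_zero]
    intro j hj
    have := Finset.mem_range.mp hj
    rw [hu j (by omega), hy j (by omega), Matrix.mulVec_zero, Matrix.mulVec_zero, add_zero]
  rw [← hx]
  ext r
  have := congrFun (h.input (t + k)) i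
  rw [hu k hk] at this
  exact this.symm

end Trajectory

/-! ### Linear algebra: first dependent vector, dimension of a product. -/

/-- A sequence of vectors is linearly independent up to the first vector in the span of its
predecessors. -/
theorem linearIndependent_or_exists_mem_span {V : Type*} [AddCommGroup V] [Module ℝ V]
    (f : ℕ → V) (N : ℕ) : LinearIndependent ℝ (fun j : Fin N => f j) ∨
      ∃ k < N, f k ∈ Submodule.span ℝ (Set.range fun j : Fin k => f j) := by
  induction N with
  | zero => exact Or.inl linearIndependent_empty_type
  | succ N ih =>
    rcases ih with h | ⟨k, hk, h⟩
    · by_cases hN : f N ∈ Submodule.span ℝ (Set.range fun j : Fin N => f j)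
      · exact Or.inr ⟨N, N.lt_succ_self, hN⟩
      · exact Or.inl (linearIndependent_finSucc'.mpr ⟨h, hN⟩)
    · exact Or.inr ⟨k, hk.trans N.lt_succ_self, h⟩

theorem finrank_submodule_prod {V W : Type*} [AddCommGroup V] [Module ℝ V] [AddCommGroup W]
    [Module ℝ W] [FiniteDimensional ℝ V] [FiniteDimensional ℝ W] (p : Submodule ℝ V)
    (q : Submodule ℝ W) :
    Module.finrank ℝ (p.prod q) = Module.finrank ℝ p + Module.finrank ℝ q := by
  have h : p.prod q = LinearMap.range (p.subtype.prodMap q.subtype) := by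
    ext z
    refine ⟨fun hz => ⟨(⟨z.1, hz.1⟩, ⟨z.2, hz.2⟩), rfl⟩, ?_⟩
    rintro ⟨w, rfl⟩
    exact ⟨w.1.2, w.2.2⟩
  rw [h, LinearMap.finrank_range_of_inj, Module.finrank_prod]
  exact Function.Injective.prodMap p.injective_subtype q.injective_subtype

/-! ### The stacked state as a shift system driven by the newest output. -/

section Shift

variable {n m l : ℕ}

/-- The estimate at time `t` together with the following `n` outputs. -/
def stackedState (n : ℕ) (xh : ℕ → Fin n → ℝ) (y : ℕ → Fin l → ℝ) (t : ℕ) :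
    (Fin n → ℝ) × (Fin n → Fin l → ℝ) :=
  (xh t, fun i => y (t + 1 + i))

/-- The inclusion of an output as the last of `n` outputs. -/
def lastOutput (n l : ℕ) : (Fin l → ℝ) →ₗ[ℝ] (Fin n → ℝ) × (Fin n → Fin l → ℝ) :=
  LinearMap.inr ℝ _ _ ∘ₗ LinearMap.pi fun i => if (i : ℕ) + 1 = n then LinearMap.id else 0

/-- The one-step evolution of the stacked state when the newest output is zero. -/
def shiftState (hn : 0 < n) (A : Matrix (Fin n) (Fin n) ℝ) (G : Matrix (Fin n) (Fin l) ℝ) :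
    (Fin n → ℝ) × (Fin n → Fin l → ℝ) →ₗ[ℝ] (Fin n → ℝ) × (Fin n → Fin l → ℝ) :=
  LinearMap.prod
    (A.mulVecLin ∘ₗ LinearMap.fst ℝ _ _ +
      G.mulVecLin ∘ₗ LinearMap.proj ⟨0, hn⟩ ∘ₗ LinearMap.snd ℝ _ _)
    (LinearMap.pi fun i => if h : (i : ℕ) + 1 < n then
      LinearMap.proj ⟨i + 1, h⟩ ∘ₗ LinearMap.snd ℝ _ _ else 0)

theorem IsCompensatorTrajectory.stackedState_succ {E : Matrix (Fin n) (Fin n) ℝ}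
    {F : Matrix (Fin n) (Fin m) ℝ} {G : Matrix (Fin n) (Fin l) ℝ} {K : Matrix (Fin m) (Fin n) ℝ}
    {xh : ℕ → Fin n → ℝ} {u : ℕ → Fin m → ℝ} {y : ℕ → Fin l → ℝ} (hn : 0 < n)
    (h : IsCompensatorTrajectory E F G K xh u y) (t : ℕ) :
    stackedState n xh y (t + 1) = shiftState hn (E + F * K) G (stackedState n xh y t) +
      lastOutput n l (y (t + 1 + n)) := by
  refine Prod.ext ?_ ?_
  · simp [stackedState, shiftState, lastOutput, h.estimate, h.input]
  · ext i r
    by_cases hi : (i : ℕ) + 1 < n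
    · have : (i : ℕ) + 1 ≠ n := by omega
      simp only [stackedState, show t + 1 + 1 + (i : ℕ) = t + 1 + (i + 1) by omega]
      simp [shiftState, lastOutput, hi, this]
    · have : (i : ℕ) + 1 = n := by omega
      simp only [stackedState, show t + 1 + 1 + (i : ℕ) = t + 1 + n by omega]
      simp [shiftState, lastOutput, this]

/-- A shift-invariant subspace that contains the newest outputs contains all outputs. -/
theorem inr_mem_of_shiftState_invariant (hn : 0 < n) {A : Matrix (Fin n) (Fin n) ℝ}
    {G : Matrix (Fin n) (Fin l) ℝ} {S : Submodule ℝ ((Fin n → ℝ) × (Fin n → Fin l → ℝ))}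
    (hlast : ∀ v, lastOutput n l v ∈ S) (hS : ∀ z ∈ S, shiftState hn A G z ∈ S)
    (Y : Fin n → Fin l → ℝ) : ((0, Y) : (Fin n → ℝ) × (Fin n → Fin l → ℝ)) ∈ S := by
  -- Induction backwards from the last slot: each shift moves an output down one slot. The estimate
  -- stays zero, since only slot `0` feeds it and the slot being shifted is `i + 1`.
  have key : ∀ k (i : Fin n), (i : ℕ) + k + 1 = n → ∀ v : Fin l → ℝ,
      ((0, Pi.single i v) : (Fin n → ℝ) × (Fin n → Fin l → ℝ)) ∈ S := by
    intro k
    induction k with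
    | zero =>
      intro i hi v
      convert hlast v using 1
      refine Prod.ext rfl ?_
      funext j
      by_cases hj : j = i
      · subst hj
        simp [lastOutput, show (j : ℕ) + 1 = n by omega]
      · have : (j : ℕ) + 1 ≠ n := fun h => hj (Fin.ext (by omega))
        simp [lastOutput, this, hj]
    | succ k ih =>
      intro i hi v
      convert hS _ (ih ⟨i + 1, by omega⟩ (by simp; omega) v) using 1
      refine Prod.ext ?_ ?_
      · simp [shiftState, Fin.ext_iff]
      · funext j
        by_cases hj : (j : ℕ) + 1 < n
        · by_cases hij : j = i
          · subst hij
            simp [shiftState, hj]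
          · have : (j : ℕ) ≠ i := fun h => hij (Fin.ext h)
            simp [shiftState, hj, hij, Fin.ext_iff, this]
        · have : j ≠ i := fun h => hj (by rw [h]; omega)
          simp [shiftState, hj, this]
  have hY : ((0, Y) : (Fin n → ℝ) × (Fin n → Fin l → ℝ)) =
      ∑ i, ((0, Pi.single i (Y i)) : (Fin n → ℝ) × (Fin n → Fin l → ℝ)) := by
    refine Prod.ext ?_ ?_
    · simp [Prod.fst_sum]
    · rw [Prod.snd_sum]
      exact (Finset.univ_sum_single Y).symm
  rw [hY]
  exact Submodule.sum_mem _ fun i _ => key (n - 1 - i) i (by omega) _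

end Shift

/-! ### Persistency of excitation and the dimension count. -/

section Excitation

variable {n m l : ℕ} {E : Matrix (Fin n) (Fin n) ℝ} {F : Matrix (Fin n) (Fin m) ℝ}
  {G : Matrix (Fin n) (Fin l) ℝ} {K : Matrix (Fin m) (Fin n) ℝ}
  {xh : ℕ → Fin n → ℝ} {u : ℕ → Fin m → ℝ} {y : ℕ → Fin l → ℝ}

/-- If a stacked state depends on its predecessors, and the span of these contains the newest
outputs, then all estimates lie in a subspace `X`, and the span is the product of `X` with the
space of all outputs. -/
theorem IsCompensatorTrajectory.exists_span_eq_prod (hn : 0 < n)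
    (h : IsCompensatorTrajectory E F G K xh u y) (t k : ℕ)
    (hk : stackedState n xh y (t + k) ∈
      Submodule.span ℝ (Set.range fun j : Fin k => stackedState n xh y (t + j)))
    (hlast : ∀ v, lastOutput n l v ∈
      Submodule.span ℝ (Set.range fun j : Fin k => stackedState n xh y (t + j))) :
    ∃ X : Submodule ℝ (Fin n → ℝ), (∀ j, xh (t + j) ∈ X) ∧
      Submodule.span ℝ (Set.range fun j : Fin k => stackedState n xh y (t + j)) = X.prod ⊤ := by
  set S := Submodule.span ℝ (Set.range fun j : Fin k => stackedState n xh y (t + j)) with hSdef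
  have hle : ∀ j ≤ k, stackedState n xh y (t + j) ∈ S := by
    intro j hj
    rcases hj.lt_or_eq with hj | rfl
    · exact Submodule.subset_span ⟨⟨j, hj⟩, rfl⟩
    · exact hk
  -- A generator is shifted to the next stacked state minus a newest output; `hk` covers the last
  -- generator.
  have hS : ∀ z ∈ S, shiftState hn (E + F * K) G z ∈ S := by
    intro z hz
    induction hz using Submodule.span_induction with
    | mem z hz =>
      obtain ⟨j, rfl⟩ := hz
      have h1 := h.stackedState_succ hn (t + j)
      rw [← sub_eq_iff_eq_add] at h1
      rw [← h1]
      exact S.sub_mem (hle (j + 1) j.2) (hlast _)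
    | zero => simp
    | add a b _ _ ha hb => rw [map_add]; exact S.add_mem ha hb
    | smul c a _ ha => rw [map_smul]; exact S.smul_mem c ha
  have hall : ∀ j, stackedState n xh y (t + j) ∈ S := by
    intro j
    induction j with
    | zero => exact hle 0 (Nat.zero_le _)
    | succ j ih =>
      rw [← add_assoc, h.stackedState_succ hn]
      exact S.add_mem (hS _ ih) (hlast _)
  have hinr := inr_mem_of_shiftState_invariant hn hlast hS
  have hfst : ∀ z ∈ S, LinearMap.inl ℝ (Fin n → ℝ) (Fin n → Fin l → ℝ) z.1 ∈ S := by
    intro z hz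
    convert S.sub_mem hz (hinr z.2) using 1
    exact Prod.ext (sub_zero _).symm (sub_self _).symm
  refine ⟨S.comap (LinearMap.inl ℝ _ _), fun j => hfst _ (hall j), ?_⟩
  ext z
  refine ⟨fun hz => ⟨hfst z hz, trivial⟩, fun hz => ?_⟩
  convert S.add_mem hz.1 (hinr z.2) using 1
  simp

/-- The stacked states satisfy the linear relations of the data columns. -/
theorem IsCompensatorTrajectory.sum_smul_stackedState_eq_zero
    (h : IsCompensatorTrajectory E F G K xh u y) (i : Fin m)
    (hobs : IsObservable E (rowMatrix K i)) {N t : ℕ} {c : Fin N → ℝ}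
    (hc : dataMatrix n N u y t *ᵥ c = 0) : ∑ j, c j • stackedState n xh y (t + j) = 0 := by
  rw [dataMatrix_mulVec] at hc
  refine Prod.ext ?_ ?_
  · simpa only [stackedState, Prod.fst_sum, Prod.smul_fst, Prod.fst_zero] using
      (h.sum_smul_shift c).estimate_eq_zero i hobs hc
  · rw [Prod.snd_sum]
    ext k r
    have := congrFun hc (Sum.inr (k, r))
    simp only [window, Sum.elim_inr, Finset.sum_apply, Pi.smul_apply, Pi.zero_apply] at this
    simp only [stackedState, Prod.smul_snd, Finset.sum_apply, Pi.smul_apply, Prod.snd_zero,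
      Pi.zero_apply]
    rw [← this]
    exact Finset.sum_congr rfl fun j _ => by
      rw [show t + (j : ℕ) + 1 + k = t + 1 + k + j by ring]

/-- The data columns of a persistently exciting trajectory are linearly independent, as soon as a
stacked state can only depend on its predecessors if their span contains the newest outputs. -/
theorem IsCompensatorTrajectory.linearIndependent_stackedState (hn : 0 < n) (hl : 0 < l)
    (h : IsCompensatorTrajectory E F G K xh u y) (i : Fin m)
    (hobs : IsObservable E (rowMatrix K i)) (hdim : n + m ≤ n * (l + 1)) (t : ℕ)
    (hgen : ∀ k, stackedState n xh y (t + k) ∈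
      Submodule.span ℝ (Set.range fun j : Fin k => stackedState n xh y (t + j)) →
      ∀ v, lastOutput n l v ∈
        Submodule.span ℝ (Set.range fun j : Fin k => stackedState n xh y (t + j)))
    (hpe : IsPersistentlyExciting (estimationMatrix E F G) (dataMatrix n (n + m) u y t)) :
    LinearIndependent ℝ (fun j : Fin (n + m) => stackedState n xh y (t + j)) := by
  rcases linearIndependent_or_exists_mem_span (fun j => stackedState n xh y (t + j)) (n + m) with
    hli | ⟨k, hk, hmem⟩
  · exact hli
  exfalso
  obtain ⟨X, hX, hS⟩ := h.exists_span_eq_prod hn t k hmem (hgen k hmem)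
  have hdimS : Module.finrank ℝ (X.prod (⊤ : Submodule ℝ (Fin n → Fin l → ℝ))) =
      Module.finrank ℝ X + n * l := by
    rw [finrank_submodule_prod, finrank_top, Module.finrank_pi_fintype]
    simp
  have hSk : Module.finrank ℝ X + n * l ≤ k := by
    rw [← hdimS, ← hS]
    simpa [Set.finrank] using
      finrank_range_le_card (R := ℝ) (fun j : Fin k => stackedState n xh y (t + j))
  set T := Fintype.linearCombination ℝ (fun j : Fin (n + m) => stackedState n xh y (t + j))
  -- `T'` records the two combinations of estimates that determine the estimation vector of a
  -- combined window: its input part is `K` applied to the second one.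
  set T' := Fintype.linearCombination ℝ (fun j : Fin (n + m) =>
    (xh (t + n + j), ∑ i : Fin n, recurrence E i • xh (t + i + j)))
  have hT : Module.finrank ℝ X + n * l ≤ Module.finrank ℝ (LinearMap.range T) := by
    rw [← hdimS, ← hS]
    refine Submodule.finrank_mono ?_
    rw [Fintype.range_linearCombination]
    refine Submodule.span_mono ?_
    rintro _ ⟨j, rfl⟩
    exact ⟨⟨j, j.2.trans hk⟩, rfl⟩
  have hT' : Module.finrank ℝ (LinearMap.range T') ≤
      Module.finrank ℝ X + Module.finrank ℝ X := by
    rw [← finrank_submodule_prod]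
    refine Submodule.finrank_mono ?_
    rw [Fintype.range_linearCombination, Submodule.span_le]
    rintro _ ⟨j, rfl⟩
    refine ⟨?_, ?_⟩
    · simpa [add_assoc] using hX (n + j)
    · change ∑ i : Fin n, recurrence E i • xh (t + i + j) ∈ X
      exact Submodule.sum_mem _ fun i _ => X.smul_mem _ (by
        rw [add_assoc]
        exact hX (i + j))
  have hker := T.finrank_range_add_finrank_ker
  have hker' := T'.finrank_range_add_finrank_ker
  rw [Module.finrank_fin_fun] at hker hker'
  -- Excitation enters here: `T' c = 0` gives `Lest H c = 0`, hence `H c = 0`, hence `T c = 0`. So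
  -- `rank T ≤ rank T'`.
  have hle : LinearMap.ker T' ≤ LinearMap.ker T := by
    intro c hc
    have hc' : T' c = 0 := hc
    have hcomb := h.sum_smul_shift c
    have h1 : ∑ j, c j • xh (t + n + j) = 0 := by
      have := congrArg Prod.fst hc'
      simpa only [T', Fintype.linearCombination_apply, Prod.fst_sum, Prod.smul_fst,
        Prod.fst_zero] using this
    have h2 : ∑ i : Fin n, recurrence E i • ∑ j, c j • xh (t + i + j) = 0 := by
      have := congrArg Prod.snd hc'
      simp only [T', Fintype.linearCombination_apply, Prod.snd_sum, Prod.smul_snd,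
        Finset.smul_sum, Prod.snd_zero] at this
      rw [Finset.sum_comm] at this
      rw [← this]
      refine Finset.sum_congr rfl fun i _ => ?_
      rw [Finset.smul_sum]
      exact Finset.sum_congr rfl fun j _ => smul_comm _ _ _
    have h3 : estimationMatrix E F G *ᵥ (dataMatrix n (n + m) u y t *ᵥ c) = 0 := by
      rw [dataMatrix_mulVec, hcomb.estimationMatrix_mulVec]
      simp only [hcomb.input, ← Matrix.mulVec_smul, ← Matrix.mulVec_sum]
      rw [h1, h2, Matrix.mulVec_zero, sub_zero]
      ext q
      simp only [Function.comp_apply]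
      rcases finSumFinEquiv.symm q with q | q <;> rfl
    have h4 : dataMatrix n (n + m) u y t *ᵥ c = 0 := by
      have : dataMatrix n (n + m) u y t *ᵥ c ∈
          LinearMap.ker (estimationMatrix E F G).mulVecLin ⊓
            LinearMap.range (dataMatrix n (n + m) u y t).mulVecLin := ⟨h3, c, rfl⟩
      rw [IsPersistentlyExciting] at hpe
      rwa [hpe] at this
    exact h.sum_smul_stackedState_eq_zero i hobs h4
  -- With `d = dim X`: `d + nl < n + m ≤ nl + n` gives `d < n`, while `d + nl ≤ 2d` gives `n ≤ nl ≤
  -- d`.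
  have := Submodule.finrank_mono hle
  have : n ≤ n * l := Nat.le_mul_of_pos_right n hl
  have : n * (l + 1) = n * l + n := by ring
  omega

/-- Independent stacked states and persistency of excitation make the estimates of the data columns
a basis. -/
theorem IsCompensatorTrajectory.isUnit_estimationMatrix_mul_dataMatrix
    (h : IsCompensatorTrajectory E F G K xh u y) (i : Fin m)
    (hobs : IsObservable E (rowMatrix K i)) (t : ℕ)
    (hli : LinearIndependent ℝ (fun j : Fin (n + m) => stackedState n xh y (t + j)))
    (hpe : IsPersistentlyExciting (estimationMatrix E F G) (dataMatrix n (n + m) u y t)) :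
    IsUnit (estimationMatrix E F G * dataMatrix n (n + m) u y t) := by
  rw [← Matrix.mulVec_injective_iff_isUnit, ← Matrix.coe_mulVecLin, ← LinearMap.ker_eq_bot,
    LinearMap.ker_eq_bot']
  intro c hc
  rw [Matrix.mulVecLin_apply, ← Matrix.mulVec_mulVec] at hc
  have hHc : dataMatrix n (n + m) u y t *ᵥ c ∈
      LinearMap.ker (estimationMatrix E F G).mulVecLin ⊓
        LinearMap.range (dataMatrix n (n + m) u y t).mulVecLin := ⟨hc, c, rfl⟩
  rw [IsPersistentlyExciting] at hpe
  rw [hpe, Submodule.mem_bot] at hHc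
  exact funext (Fintype.linearIndependent_iff.mp hli c
    (h.sum_smul_stackedState_eq_zero i hobs hHc))

/-- The first columns of a longer data matrix determine the gain. -/
theorem IsCompensatorTrajectory.inputMatrix_eq_mul_iff
    (h : IsCompensatorTrajectory E F G K xh u y) {t c : ℕ} (hc : n + m ≤ c)
    (hu : IsUnit (estimationMatrix E F G * dataMatrix n (n + m) u y t))
    {P : Matrix (Fin (n + m)) (Fin (n + m)) ℝ}
    {L : Matrix (Fin (n + m)) ((Fin n × Fin m) ⊕ (Fin n × Fin l)) ℝ}
    (hP : IsUnit P) (hL : estimationMatrix E F G = P * L)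
    (M : Matrix (Fin m) (Fin (n + m)) ℝ) :
    inputMatrix n c u t = M * L * dataMatrix n c u y t ↔ M = controlMatrix K * P := by
  rw [h.inputMatrix_eq]
  constructor
  · intro heq
    have h1 : controlMatrix K * (estimationMatrix E F G * dataMatrix n (n + m) u y t) =
        M * L * dataMatrix n (n + m) u y t := by
      ext a b
      exact congrFun (congrFun heq a) (Fin.castLE hc b)
    rw [hL] at h1 hu
    have h2 : IsUnit (L * dataMatrix n (n + m) u y t) := by
      rw [Matrix.mul_assoc] at hu
      obtain ⟨P, rfl⟩ := hP
      exact P.isUnit_units_mul _ |>.mp hu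
    rw [Matrix.mul_assoc P, ← Matrix.mul_assoc, Matrix.mul_assoc M] at h1
    have h3 := (Matrix.isUnit_iff_isUnit_det _).mp h2
    have h4 := congrArg (· * (L * dataMatrix n (n + m) u y t)⁻¹) h1
    simpa only [Matrix.mul_nonsing_inv_cancel_right _ _ h3] using h4.symm
  · rintro rfl
    rw [hL]
    simp only [Matrix.mul_assoc]

end Excitation

/-! ### Gaussian perturbations and random subspaces. -/

/-- Once the coefficients are confined to a compact ball, membership is the projection of a closed
set along a compact factor, hence closed. The set is the countable union over integer radii. -/
theorem measurableSet_mem_span_range {V : Type*} [NormedAddCommGroup V] [NormedSpace ℝ V]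
    [MeasurableSpace V] [BorelSpace V] [SecondCountableTopology V] (k : ℕ) :
    MeasurableSet {p : (Fin k → V) × V | p.2 ∈ Submodule.span ℝ (Set.range p.1)} := by
  have h : {p : (Fin k → V) × V | p.2 ∈ Submodule.span ℝ (Set.range p.1)} =
      ⋃ M : ℕ, Prod.fst '' {q : ((Fin k → V) × V) × Metric.closedBall (0 : Fin k → ℝ) M |
        ∑ j, q.2.1 j • q.1.1 j = q.1.2} := by
    ext p
    simp only [Set.mem_ofPred_eq, Submodule.mem_span_range_iff_exists_fun, Set.mem_iUnion,
      Set.mem_image]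
    constructor
    · rintro ⟨c, hc⟩
      obtain ⟨M, hM⟩ := exists_nat_ge ‖c‖
      exact ⟨M, (p, ⟨c, by simpa using hM⟩), hc, rfl⟩
    · rintro ⟨M, q, hq, rfl⟩
      exact ⟨q.2.1, hq⟩
  rw [h]
  refine MeasurableSet.iUnion fun M => IsClosed.measurableSet ?_
  refine isClosedMap_fst_of_compactSpace _ (isClosed_eq ?_ (by fun_prop))
  exact continuous_finsetSum _ fun j _ =>
    (((continuous_apply j).comp (continuous_subtype_val.comp continuous_snd))).smul
      ((continuous_apply j).comp (continuous_fst.comp continuous_fst))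

section Gaussian

variable {Ω : Type*} [MeasurableSpace Ω] {μ : Measure Ω} {l : ℕ}

/-- A nondegenerate Gaussian vector gives no mass to affine hyperplanes. -/
theorem multivariateGaussian_hyperplane {V : Matrix (Fin l) (Fin l) ℝ} (hV : V.PosDef)
    {L : StrongDual ℝ (EuclideanSpace ℝ (Fin l))} (hL : L ≠ 0) (c : ℝ) :
    multivariateGaussian 0 V (L ⁻¹' {c}) = 0 := by
  rw [← Measure.map_apply (by fun_prop) (measurableSet_singleton c),
    IsGaussian.map_eq_gaussianReal]
  obtain ⟨g, rfl⟩ := (InnerProductSpace.toDual ℝ (EuclideanSpace ℝ (Fin l))).surjective L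
  have hg : g ≠ 0 := by rintro rfl; exact hL (map_zero _)
  -- The functional has a real Gaussian law of variance `gᵀ V g > 0`, which has no atoms.
  have hvar : Var[InnerProductSpace.toDual ℝ (EuclideanSpace ℝ (Fin l)) g;
      multivariateGaussian 0 V] = g ⬝ᵥ V *ᵥ g := by
    rw [← covarianceBilin_multivariateGaussian (μ := 0) hV.posSemidef g g,
      covarianceBilin_apply_eq_cov IsGaussian.memLp_two_id, covariance_self (by fun_prop)]
    rfl
  have hpos : 0 < (g : Fin l → ℝ) ⬝ᵥ V *ᵥ g := by
    have := hV.dotProduct_mulVec_pos (x := (g : Fin l → ℝ))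
      (fun h => hg (by ext i; exact congrFun h i))
    simpa using this
  have := nullSingletonClass_gaussianReal
    (μ := ∫ x, InnerProductSpace.toDual ℝ (EuclideanSpace ℝ (Fin l)) g x
      ∂(multivariateGaussian 0 V)) (v := (g ⬝ᵥ V *ᵥ g).toNNReal) (by simpa using hpos)
  rw [hvar]
  exact measure_singleton c

theorem map_hyperplane_eq_zero {V : Matrix (Fin l) (Fin l) ℝ} (hV : V.PosDef)
    {ξ : Ω → Fin l → ℝ} (hξ : Measurable ξ)
    (hlaw : μ.map (fun ω => WithLp.toLp 2 (ξ ω)) = multivariateGaussian 0 V)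
    {φ : (Fin l → ℝ) →ₗ[ℝ] ℝ} (hφ : φ ≠ 0) (c : ℝ) :
    μ.map ξ {v | φ v = c} = 0 := by
  set L : StrongDual ℝ (EuclideanSpace ℝ (Fin l)) :=
    LinearMap.toContinuousLinearMap (φ ∘ₗ (WithLp.linearEquiv 2 ℝ (Fin l → ℝ)).toLinearMap)
  have hL : L ≠ 0 := by
    intro h
    apply hφ
    ext1 v
    ext
    simpa [L] using congrArg (fun f : StrongDual ℝ (EuclideanSpace ℝ (Fin l)) =>
      f (WithLp.toLp 2 (Pi.single v 1))) h
  have h := multivariateGaussian_hyperplane hV hL c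
  have hφm : Measurable φ := (LinearMap.continuous_of_finiteDimensional φ).measurable
  rw [← hlaw, Measure.map_apply (by fun_prop) (L.measurable (measurableSet_singleton c))] at h
  exact (Measure.map_apply hξ (hφm (measurableSet_singleton c))).trans h

/-- A vector perturbed by an independent nondegenerate Gaussian almost surely lies in a random
subspace only if the subspace contains all directions of perturbation. -/
theorem ae_mem_span_of_add_mem_span [IsProbabilityMeasure μ] {X : Type*} [NormedAddCommGroup X]
    [NormedSpace ℝ X] [MeasurableSpace X] [BorelSpace X] [SecondCountableTopology X]
    {V : Matrix (Fin l) (Fin l) ℝ} (hV : V.PosDef)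
    {ξ : Ω → Fin l → ℝ} (hξ : Measurable ξ)
    (hlaw : μ.map (fun ω => WithLp.toLp 2 (ξ ω)) = multivariateGaussian 0 V)
    (D : (Fin l → ℝ) →ₗ[ℝ] X) {k : ℕ} {f : Ω → Fin k → X} {g : Ω → X}
    (hf : Measurable f) (hg : Measurable g) (hind : IndepFun (fun ω => (f ω, g ω)) ξ μ) :
    ∀ᵐ ω ∂μ, g ω + D (ξ ω) ∈ Submodule.span ℝ (Set.range (f ω)) →
      ∀ v, D v ∈ Submodule.span ℝ (Set.range (f ω)) := by
  have hD : Measurable D := (LinearMap.continuous_of_finiteDimensional D).measurable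
  have key : ∀ i : Fin l, ∀ᵐ ω ∂μ, g ω + D (ξ ω) ∈ Submodule.span ℝ (Set.range (f ω)) →
      D (Pi.single i 1) ∈ Submodule.span ℝ (Set.range (f ω)) := by
    intro i
    set bad : Set (((Fin k → X) × X) × (Fin l → ℝ)) :=
      {q | q.1.2 + D q.2 ∈ Submodule.span ℝ (Set.range q.1.1)} ∩
        {q | D (Pi.single i 1) ∈ Submodule.span ℝ (Set.range q.1.1)}ᶜ with hbad
    have hm1 : Measurable fun q : ((Fin k → X) × X) × (Fin l → ℝ) => (q.1.1, q.1.2 + D q.2) := by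
      fun_prop
    have hm2 : Measurable fun q : ((Fin k → X) × X) × (Fin l → ℝ) =>
      (q.1.1, D (Pi.single i 1)) := by fun_prop
    have hmeas : MeasurableSet bad :=
      (hm1 (measurableSet_mem_span_range k)).inter (hm2 (measurableSet_mem_span_range k)).compl
    have hnull : (μ.map (fun ω => ((f ω, g ω), ξ ω))) bad = 0 := by
      have hprob : IsProbabilityMeasure (μ.map ξ) :=
        Measure.isProbabilityMeasure_map hξ.aemeasurable
      rw [(indepFun_iff_map_prod_eq_prod_map_map (hf.prodMk hg).aemeasurable
        hξ.aemeasurable).mp hind, Measure.measure_prod_null hmeas]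
      refine Filter.Eventually.of_forall fun p => ?_
      by_cases hp : D (Pi.single i 1) ∈ Submodule.span ℝ (Set.range p.1)
      · have : Prod.mk p ⁻¹' bad = ∅ := by
          ext v
          simp [hbad, hp]
        simp [this]
      -- Fubini reduces to a fixed span. A functional vanishing on it but not on `D e_i` confines
      -- the noise to an affine hyperplane, which is null.
      · obtain ⟨φ, hφ, hker⟩ := Submodule.exists_le_ker_of_notMem hp
        have hφD : φ ∘ₗ D ≠ 0 := fun h => hφ (LinearMap.congr_fun h (Pi.single i 1))
        refine measure_mono_null ?_ (map_hyperplane_eq_zero hV hξ hlaw hφD (-φ p.2))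
        intro v hv
        have h0 : φ (p.2 + D v) = 0 := hker hv.1
        rw [map_add] at h0
        exact eq_neg_of_add_eq_zero_right h0
    rw [Measure.map_apply ((hf.prodMk hg).prodMk hξ) hmeas] at hnull
    rw [ae_iff]
    convert hnull using 2
    ext ω
    simp [hbad]
  filter_upwards [ae_all_iff.mpr key] with ω hω hmem v
  rw [← Finset.univ_sum_single v, map_sum]
  refine Submodule.sum_mem _ fun i _ => ?_
  have : Pi.single i (v i) = v i • (Pi.single i 1 : Fin l → ℝ) := by
    rw [← Pi.single_smul, smul_eq_mul, mul_one]
  rw [this, map_smul]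
  exact Submodule.smul_mem _ _ (hω i hmem)

end Gaussian

/-! ### Independence of the newest measurement noise from the past. -/

theorem indepFun_prodMk_assoc {Ω α β γ : Type*} [MeasurableSpace Ω] [MeasurableSpace α]
    [MeasurableSpace β] [MeasurableSpace γ] {μ : Measure Ω} [IsProbabilityMeasure μ]
    {X : Ω → α} {Y : Ω → β} {Z : Ω → γ} (hX : Measurable X) (hY : Measurable Y)
    (hZ : Measurable Z) (h1 : IndepFun X (fun ω => (Y ω, Z ω)) μ) (h2 : IndepFun Y Z μ) :
    IndepFun (fun ω => (X ω, Y ω)) Z μ := by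
  have hXp : IsProbabilityMeasure (μ.map X) := Measure.isProbabilityMeasure_map hX.aemeasurable
  have hYp : IsProbabilityMeasure (μ.map Y) := Measure.isProbabilityMeasure_map hY.aemeasurable
  have hZp : IsProbabilityMeasure (μ.map Z) := Measure.isProbabilityMeasure_map hZ.aemeasurable
  have h12 : IndepFun X Y μ := h1.comp measurable_id measurable_fst
  rw [indepFun_iff_map_prod_eq_prod_map_map (by fun_prop) (by fun_prop)] at *
  rw [h12, ← MeasurableEquiv.prodAssoc.map_measurableEquiv_injective.eq_iff,
    Measure.prodAssoc_prod, ← h2, ← h1,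
    Measure.map_map MeasurableEquiv.prodAssoc.measurable (by fun_prop)]
  rfl

section Past

variable {n m l : ℕ} {Ω : Type*}
  {W : Matrix (Fin n) (Fin n) ℝ} {V : Matrix (Fin l) (Fin l) ℝ}
  {x xh : ℕ → Ω → Fin n → ℝ} {u : ℕ → Ω → Fin m → ℝ} {y : ℕ → Ω → Fin l → ℝ}
  {w : ℕ → Ω → Fin n → ℝ} {v : ℕ → Ω → Fin l → ℝ}

/-- The initial states, the process noise at all times, and the measurement noise at the times
`1, …, s`. -/
def past (x0 xh0 : Ω → Fin n → ℝ) (w : ℕ → Ω → Fin n → ℝ) (v : ℕ → Ω → Fin l → ℝ) (s : ℕ) (ω : Ω) :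
    ((Fin n → ℝ) × (Fin n → ℝ)) × (ℕ → Fin n → ℝ) × (Fin s → Fin l → ℝ) :=
  ((x0 ω, xh0 ω), (fun t => w t ω, fun j => v (j + 1) ω))

theorem measurable_mulVec_comp {p q : ℕ} {mΩ : MeasurableSpace Ω} (M : Matrix (Fin p) (Fin q) ℝ)
    {f : Ω → Fin q → ℝ} (hf : Measurable f) : Measurable fun ω => M *ᵥ f ω :=
  (LinearMap.continuous_of_finiteDimensional M.mulVecLin).measurable.comp hf

/-- The closed loop up to time `s`, and the state at time `s + 1`, only depend on the initial
states and the noise in the past. -/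
theorem measurable_comap_past {A : Matrix (Fin n) (Fin n) ℝ} {B : Matrix (Fin n) (Fin m) ℝ}
    {C : Matrix (Fin l) (Fin n) ℝ} {E : Matrix (Fin n) (Fin n) ℝ} {F : Matrix (Fin n) (Fin m) ℝ}
    {G : Matrix (Fin n) (Fin l) ℝ} {K : Matrix (Fin m) (Fin n) ℝ}
    (hs : ∀ ω, IsSystemTrajectory A B C (w · ω) (v · ω) (x · ω) (u · ω) (y · ω))
    (hc : ∀ ω, IsCompensatorTrajectory E F G K (xh · ω) (u · ω) (y · ω)) (s : ℕ) :
    (∀ τ ≤ s, Measurable[MeasurableSpace.comap (past (x 0) (xh 0) w v s) inferInstance] (xh τ)) ∧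
    (∀ τ ≤ s + 1, Measurable[MeasurableSpace.comap (past (x 0) (xh 0) w v s) inferInstance] (x τ)) ∧
    (∀ τ, 0 < τ → τ ≤ s →
      Measurable[MeasurableSpace.comap (past (x 0) (xh 0) w v s) inferInstance] (y τ)) := by
  set m0 := MeasurableSpace.comap (past (x 0) (xh 0) w v s) inferInstance with hm0
  have hp : Measurable[m0] (past (x 0) (xh 0) w v s) := comap_measurable _
  have hx0 : Measurable[m0] (x 0) := measurable_fst.comp (measurable_fst.comp hp)
  have hxh0 : Measurable[m0] (xh 0) := measurable_snd.comp (measurable_fst.comp hp)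
  have hw : ∀ τ, Measurable[m0] (w τ) := fun τ =>
    (measurable_pi_apply τ).comp (measurable_fst.comp (measurable_snd.comp hp))
  have hv : ∀ τ < s, Measurable[m0] (v (τ + 1)) := fun τ hτ =>
    (measurable_pi_apply (⟨τ, hτ⟩ : Fin s)).comp (measurable_snd.comp (measurable_snd.comp hp))
  have hxs : ∀ τ, Measurable[m0] (xh τ) → Measurable[m0] (x τ) → Measurable[m0] (x (τ + 1)) := by
    intro τ h1 h2
    have : x (τ + 1) = fun ω => A *ᵥ x τ ω + B *ᵥ (K *ᵥ xh τ ω) + w τ ω := by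
      funext ω
      rw [(hs ω).state, (hc ω).input]
    rw [this]
    exact ((measurable_mulVec_comp A h2).add
      (measurable_mulVec_comp B (measurable_mulVec_comp K h1))).add (hw τ)
  have hys : ∀ τ < s, Measurable[m0] (x (τ + 1)) → Measurable[m0] (y (τ + 1)) := by
    intro τ hτ h1
    have : y (τ + 1) = fun ω => C *ᵥ x (τ + 1) ω + v (τ + 1) ω := by
      funext ω
      rw [(hs ω).output]
    rw [this]
    exact (measurable_mulVec_comp C h1).add (hv τ hτ)
  have hboth : ∀ τ ≤ s, Measurable[m0] (xh τ) ∧ Measurable[m0] (x τ) := by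
    intro τ
    induction τ with
    | zero => exact fun _ => ⟨hxh0, hx0⟩
    | succ τ ih =>
      intro hτ
      obtain ⟨h1, h2⟩ := ih (by omega)
      have h3 := hxs τ h1 h2
      refine ⟨?_, h3⟩
      have : xh (τ + 1) = fun ω => E *ᵥ xh τ ω + F *ᵥ (K *ᵥ xh τ ω) + G *ᵥ y (τ + 1) ω := by
        funext ω
        rw [(hc ω).estimate, (hc ω).input]
      rw [this]
      exact ((measurable_mulVec_comp E h1).add
        (measurable_mulVec_comp F (measurable_mulVec_comp K h1))).add
        (measurable_mulVec_comp G (hys τ (by omega) h3))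
  have hx : ∀ τ ≤ s + 1, Measurable[m0] (x τ) := by
    intro τ hτ
    rcases τ with _ | τ
    · exact hx0
    · exact hxs τ (hboth τ (by omega)).1 (hboth τ (by omega)).2
  refine ⟨fun τ hτ => (hboth τ hτ).1, hx, fun τ h0 hτ => ?_⟩
  obtain ⟨τ, rfl⟩ := Nat.exists_eq_succ_of_ne_zero h0.ne'
  exact hys τ (by omega) (hx _ (by omega))

variable [MeasurableSpace Ω] {μ : Measure Ω}

theorem IsNoise.measurable_past {x0 xh0 : Ω → Fin n → ℝ} (h : IsNoise μ W V x0 xh0 w v) (s : ℕ) :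
    Measurable (past x0 xh0 w v s) := by
  have h1 := h.measurable_x0
  have h2 := h.measurable_xh0
  have h3 := h.measurable_w
  have h4 := h.measurable_v
  exact (h1.prodMk h2).prodMk ((measurable_pi_lambda _ h3).prodMk
    (measurable_pi_lambda _ fun j => h4 _))

/-- The initial states, then the process noise, then the earlier measurement noise are split off in
turn. `v 0` is left out of the past because the initial states may depend on it. -/
theorem IsNoise.indepFun_past [IsProbabilityMeasure μ] {x0 xh0 : Ω → Fin n → ℝ}
    (h : IsNoise μ W V x0 xh0 w v) (s : ℕ) :
    IndepFun (past x0 xh0 w v s) (v (s + 1)) μ := by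
  have h1 := h.measurable_x0
  have h2 := h.measurable_xh0
  have h3 : Measurable fun ω t => w t ω := measurable_pi_lambda _ h.measurable_w
  have h4 := h.measurable_v
  have h5 : Measurable fun ω (j : Fin s) => v (j + 1) ω := measurable_pi_lambda _ fun j => h4 _
  refine indepFun_prodMk_assoc (h1.prodMk h2) (h3.prodMk h5) (h4 _) ?_ ?_
  · refine h.indep_initial.comp
      (φ := fun p : (Fin n → ℝ) × (Fin n → ℝ) × (Fin l → ℝ) => (p.1, p.2.1))
      (ψ := fun p : (ℕ → Fin n → ℝ) × (ℕ → Fin l → ℝ) =>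
        ((p.1, fun j : Fin s => p.2 j), p.2 s)) (by fun_prop) (by fun_prop)
  · refine indepFun_prodMk_assoc h3 h5 (h4 _) ?_ ?_
    · exact h.indep_w_v.comp (φ := id)
        (ψ := fun p : ℕ → Fin l → ℝ => (fun j : Fin s => p (j + 1), p (s + 1)))
        measurable_id (by fun_prop)
    · have hd : Disjoint (Finset.Icc 1 s) {s + 1} := by simp
      exact (h.indep_v.indepFun_finset _ _ hd h4).comp
        (φ := fun (p : Finset.Icc 1 s → Fin l → ℝ) (j : Fin s) =>
          p ⟨j + 1, Finset.mem_Icc.mpr ⟨by omega, j.2⟩⟩)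
        (ψ := fun p : ({s + 1} : Finset ℕ) → Fin l → ℝ => p ⟨s + 1, Finset.mem_singleton_self _⟩)
        (by fun_prop) (by fun_prop)

/-- Along the closed loop, a stacked state almost surely depends on its predecessors only if
their span contains the newest outputs. -/
theorem ae_lastOutput_mem_span [IsProbabilityMeasure μ] (hn : 0 < n) (hV : V.PosDef)
    {A : Matrix (Fin n) (Fin n) ℝ} {B : Matrix (Fin n) (Fin m) ℝ}
    {C : Matrix (Fin l) (Fin n) ℝ} {E : Matrix (Fin n) (Fin n) ℝ} {F : Matrix (Fin n) (Fin m) ℝ}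
    {G : Matrix (Fin n) (Fin l) ℝ} {K : Matrix (Fin m) (Fin n) ℝ}
    (hnoise : IsNoise μ W V (x 0) (xh 0) w v)
    (hs : ∀ ω, IsSystemTrajectory A B C (w · ω) (v · ω) (x · ω) (u · ω) (y · ω))
    (hc : ∀ ω, IsCompensatorTrajectory E F G K (xh · ω) (u · ω) (y · ω)) (t k : ℕ) :
    ∀ᵐ ω ∂μ, stackedState n (xh · ω) (y · ω) (t + k) ∈
        Submodule.span ℝ (Set.range fun j : Fin k => stackedState n (xh · ω) (y · ω) (t + j)) →
      ∀ z, lastOutput n l z ∈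
        Submodule.span ℝ (Set.range fun j : Fin k => stackedState n (xh · ω) (y · ω) (t + j)) := by
  -- The newest output of the stacked state at `t + k` has time `t + k + n = s + 1`, positive
  -- because `n > 0`.
  obtain ⟨s, hsn⟩ : ∃ s, t + k + n = s + 1 := ⟨t + k + n - 1, by omega⟩
  obtain ⟨hxh, hx, hy⟩ := measurable_comap_past hs hc s
  have hle : MeasurableSpace.comap (past (x 0) (xh 0) w v s) inferInstance ≤
      ‹MeasurableSpace Ω› := (hnoise.measurable_past s).comap_le
  set f : Ω → Fin k → (Fin n → ℝ) × (Fin n → Fin l → ℝ) :=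
    fun ω j => stackedState n (xh · ω) (y · ω) (t + j) with hfdef
  -- `g` is the stacked state with the noise `v (s + 1)` removed from its newest output. Both `f`
  -- and `g` are then functions of the past.
  set g : Ω → (Fin n → ℝ) × (Fin n → Fin l → ℝ) := fun ω =>
    (xh (t + k) ω, fun i => if (i : ℕ) + 1 = n then C *ᵥ x (s + 1) ω else y (t + k + 1 + i) ω)
    with hgdef
  have hf : Measurable[MeasurableSpace.comap (past (x 0) (xh 0) w v s) inferInstance] f := by
    refine @measurable_pi_lambda _ _ _ (_) _ _ fun j => ?_
    refine Measurable.prodMk (hxh _ (by omega)) (@measurable_pi_lambda _ _ _ (_) _ _ fun i => ?_)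
    exact hy _ (by omega) (by omega)
  have hg : Measurable[MeasurableSpace.comap (past (x 0) (xh 0) w v s) inferInstance] g := by
    refine Measurable.prodMk (hxh _ (by omega)) (@measurable_pi_lambda _ _ _ (_) _ _ fun i => ?_)
    by_cases hi : (i : ℕ) + 1 = n
    · simp only [if_pos hi]
      exact measurable_mulVec_comp C (hx _ le_rfl)
    · simp only [if_neg hi]
      exact hy _ (by omega) (by omega)
  have hind : IndepFun (fun ω => (f ω, g ω)) (v (s + 1)) μ := by
    rw [IndepFun_iff_Indep]
    exact indep_of_indep_of_le_left ((IndepFun_iff_Indep _ _ _).mp (hnoise.indepFun_past s))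
      (Measurable.comap_le (Measurable.prodMk hf hg))
  filter_upwards [ae_mem_span_of_add_mem_span hV (hnoise.measurable_v _) (hnoise.law_v _)
    (lastOutput n l) (hf.mono hle le_rfl) (hg.mono hle le_rfl) hind] with ω hω hmem
  refine hω ?_
  convert hmem using 1
  refine Prod.ext ?_ ?_
  · simp [hgdef, lastOutput, stackedState]
  · funext i
    by_cases hi : (i : ℕ) + 1 = n
    · have := (hs ω).output (s + 1)
      rw [← hsn] at this
      simp only [hgdef, lastOutput, stackedState, show t + k + 1 + (i : ℕ) = t + k + n by omega,
        this]
      simp [hi, hsn]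
    · simp [hgdef, lastOutput, stackedState, hi]

end Past

end LQG

end

/-! ### Assembly. -/

theorem theorem3 {n m l : ℕ} (hn : 0 < n)
    (A : Matrix (Fin n) (Fin n) ℝ) (B : Matrix (Fin n) (Fin m) ℝ) (C : Matrix (Fin l) (Fin n) ℝ)
    (W : Matrix (Fin n) (Fin n) ℝ) (V : Matrix (Fin l) (Fin l) ℝ)
    (hW : W.PosSemidef) (hV : V.PosDef)
    (hAB : LQG.IsControllable A B) (hAW : LQG.IsControllable A (CFC.sqrt W))
    (hAC : LQG.IsObservable A C)
    (Q : Matrix (Fin n) (Fin n) ℝ) (R : Matrix (Fin m) (Fin m) ℝ)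
    (hQ : Q.PosSemidef) (hR : R.PosDef) (hAQ : LQG.IsObservable A (CFC.sqrt Q))
    (Klqr : Matrix (Fin m) (Fin n) ℝ) (hK : LQG.IsLQRGain A B Q R Klqr)
    (Lf : Matrix (Fin n) (Fin l) ℝ) (hL : LQG.IsKalmanGain A C W V Lf)
    (E : Matrix (Fin n) (Fin n) ℝ) (hE : E = LQG.compE A C Lf)
    (F : Matrix (Fin n) (Fin m) ℝ) (hF : F = LQG.compF B C Lf)
    (hobs : ∀ i, LQG.IsObservable E (LQG.rowMatrix Klqr i))
    (hctr : LQG.IsControllable E Lf)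
    (Lest : Matrix (Fin (n + m)) ((Fin n × Fin m) ⊕ (Fin n × Fin l)) ℝ)
    (hLest : Lest = LQG.estimationMatrix E F Lf) :
    Lest.rank = n + m ∧
    (n + m ≤ n * (l + 1) →
      ∀ {Ω : Type*} [MeasurableSpace Ω] (μ : Measure Ω) [IsProbabilityMeasure μ]
        (w : ℕ → Ω → Fin n → ℝ) (v : ℕ → Ω → Fin l → ℝ)
        (x xh : ℕ → Ω → Fin n → ℝ) (u : ℕ → Ω → Fin m → ℝ) (y : ℕ → Ω → Fin l → ℝ),
        LQG.IsNoise μ W V (x 0) (xh 0) w v →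
        (∀ ω, LQG.IsSystemTrajectory A B C (w · ω) (v · ω) (x · ω) (u · ω) (y · ω)) →
        (∀ ω, LQG.IsCompensatorTrajectory E F Lf Klqr (xh · ω) (u · ω) (y · ω)) →
        ∀ t : ℕ, ∀ᵐ ω ∂μ,
          LQG.IsPersistentlyExciting Lest (LQG.dataMatrix n (n + m) (u · ω) (y · ω) t) →
          IsUnit (Lest * LQG.dataMatrix n (n + m) (u · ω) (y · ω) t) ∧
          LQG.controlMatrix Klqr = LQG.inputMatrix n (n + m) (u · ω) t *
            (Lest * LQG.dataMatrix n (n + m) (u · ω) (y · ω) t)⁻¹ ∧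
          LQG.IsStaticGain E F Lf Klqr (LQG.controlMatrix Klqr * Lest) ∧
          ∀ Tbar : ℕ, 2 * n + m ≤ Tbar + 1 →
            ∀ (P : Matrix (Fin (n + m)) (Fin (n + m)) ℝ)
              (Lhat : Matrix (Fin (n + m)) ((Fin n × Fin m) ⊕ (Fin n × Fin l)) ℝ),
              IsUnit P → Lest = P * Lhat →
              ∀ Khat : Matrix (Fin m) (Fin (n + m)) ℝ,
                LQG.inputMatrix n (Tbar - n + 1) (u · ω) t =
                    Khat * Lhat * LQG.dataMatrix n (Tbar - n + 1) (u · ω) (y · ω) t ↔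
                  Khat = LQG.controlMatrix Klqr * P) := by
  subst hE hF hLest
  have hm : 0 < m := hAB.pos_of_pos hn
  have hl : 0 < l := hAC.pos_of_pos hn
  have hdet := LQG.det_compE_ne_zero hV hK hL ⟨0, hm⟩ (hobs _)
  refine ⟨LQG.rank_estimationMatrix hn _ hdet hctr, ?_⟩
  intro hdim Ω _ μ _ w v x xh u y hnoise hs hc t
  -- The exceptional null sets for the countably many `k` are united; from here on the argument is
  -- pathwise.
  filter_upwards [ae_all_iff.mpr (LQG.ae_lastOutput_mem_span hn hV hnoise hs hc t)]
    with ω hω hpe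
  have hli := (hc ω).linearIndependent_stackedState hn hl ⟨0, hm⟩ (hobs _) hdim t hω hpe
  have hu := (hc ω).isUnit_estimationMatrix_mul_dataMatrix ⟨0, hm⟩ (hobs _) t hli hpe
  refine ⟨hu, ?_, LQG.isStaticGain_controlMatrix_mul_estimationMatrix _ _ _ _, ?_⟩
  · rw [(hc ω).inputMatrix_eq,
      Matrix.mul_nonsing_inv_cancel_right _ _ ((Matrix.isUnit_iff_isUnit_det _).mp hu)]
  · intro Tbar hT P Lhat hP hLhat Khat
    -- The length bound `2n + m ≤ Tbar + 1` says exactly that the `Tbar - n + 1` columns number at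
    -- least `n + m`.
    exact (hc ω).inputMatrix_eq_mul_iff (by omega) hu hP hLhat Khat
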